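/- Let $w\in S_n$. An inversion of $w$ is a pair $(a,b)$ with $1\le a<b\le n$ and $w(a)>w(b)$; let $\mathrm{Inv}(w)$ be the set of inversions and $\ell(w)$ the Coxeter length of $w$. Write $u\lessdot v$ for a covering in the strong Bruhat order, i.e. $v=ut_{ab}$ for some $a<b$ and $\ell(v)=\ell(u)+1$, where $ut_{ab}$ is $u$ with the values in positions $a$ and $b$ exchanged; such a covering has weight $x_a+x_{a+1}+\cdots+x_{b-1}$. The dual Schubert polynomial is $$D^w(x_1,\dots,x_{n-1})=\frac1{\ell(w)!}\sum_C m_C,$$ where $C$ runs over the saturated chains $\mathrm{id}=u_0\lessdot u_1\lessdot\cdots\lessdot u_{\ell(w)}=w$ and $m_C$ is the product of the weights of the coverings in $C$. Let $\mathrm{Newton}(D^w)\subset\mathbb R^{n-1}$ be the convex hull of the exponent vectors of $D^w$. Consider the Young diagram of staircase shape $(n-1,n-2,\dots,1)$, and label the boxes of its $i$th row, from left to right, by $(i,n),(i,n-1),\dots,(i,i+1)$. Write $1$ in a box if its label belongs to $\mathrm{Inv}(w)$, and $0$ otherwise. For each tiling of the diagram by $n-1$ rectangles, write the sum of the entries of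 each rectangle at its bottom right corner. Then for every such tiling the bottom right corners of the rectangles lie in distinct rows, so that reading the sums from top to bottom gives a well-defined vector in $\mathbb Z_{\ge0}^{n-1}$. The vectors obtained in this way from all the tilings of the diagram by $n-1$ rectangles are exactly the vertices of $\mathrm{Newton}(D^w)$: each tiling gives a vertex, and every vertex arises from some tiling. -/

import Mathlib

open scoped Nat

namespace DualSchubert

variable {n : ℕ}

/-! ### Permutations

`S_n` is `Equiv.Perm (Fin n)`; positions and variables are indexed from `0`, so the position
`a ∈ {1, …, n}` is the element `a - 1` of `Fin n`, and the variable `x_i` with `1 ≤ i ≤ n - 1` is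
`X (i - 1)` with `i - 1 : Fin (n - 1)`. -/

/-- The set `Inv(w)` of inversions of `w`: pairs of positions `a < b` with `w(a) > w(b)`. -/
def inversions (w : Equiv.Perm (Fin n)) : Finset (Fin n × Fin n) :=
  Finset.univ.filter fun p => p.1 < p.2 ∧ w p.2 < w p.1

/-- The simple transposition exchanging the consecutive elements `i` and `i + 1`. -/
def simpleTransposition (i : Fin (n - 1)) : Equiv.Perm (Fin n) :=
  Equiv.swap ⟨i.val, by omega⟩ ⟨i.val + 1, by omega⟩

/-- The Coxeter length `ℓ(w)`: the least length of a word in the simple transpositions with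
product `w`. -/
noncomputable def coxeterLength (w : Equiv.Perm (Fin n)) : ℕ :=
  sInf {k | ∃ s : List (Fin (n - 1)), s.length = k ∧ (s.map simpleTransposition).prod = w}

/-- The covering relation `u ⋖ v` of the strong Bruhat order: `v = u t_{ab}` for some `a < b`, and
`ℓ(v) = ℓ(u) + 1`. Here `u * Equiv.swap a b` is `u` with the values in positions `a`, `b`
exchanged. -/
def BruhatCovers (u v : Equiv.Perm (Fin n)) : Prop :=
  (∃ a b : Fin n, a < b ∧ v = u * Equiv.swap a b) ∧ coxeterLength v = coxeterLength u + 1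

/-! ### Dual Schubert polynomials -/

/-- The linear form `x_a + x_{a+1} + ⋯ + x_{b-1}`. -/
noncomputable def intervalForm (a b : Fin n) : MvPolynomial (Fin (n - 1)) ℝ :=
  ∑ i ∈ Finset.univ.filter (fun i : Fin (n - 1) => a.val ≤ i.val ∧ i.val < b.val),
    MvPolynomial.X i

/-- The weight of an edge from `u` to `v = u t_{ab}` with `a < b`, namely
`x_a + x_{a+1} + ⋯ + x_{b-1}`. It is written as a sum over all pairs `a < b` with `v = u t_{ab}`;
there is only one such pair, see `edgeWeight_mul_swap`. -/
noncomputable def edgeWeight (u v : Equiv.Perm (Fin n)) : MvPolynomial (Fin (n - 1)) ℝ :=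
  ∑ p ∈ Finset.univ.filter
      (fun p : Fin n × Fin n => p.1 < p.2 ∧ v = u * Equiv.swap p.1 p.2),
    intervalForm p.1 p.2

theorem edgeWeight_mul_swap (u : Equiv.Perm (Fin n)) {a b : Fin n} (hab : a < b) :
    edgeWeight u (u * Equiv.swap a b) = intervalForm a b := by
  have h : (Finset.univ.filter (fun p : Fin n × Fin n =>
      p.1 < p.2 ∧ u * Equiv.swap a b = u * Equiv.swap p.1 p.2)) = {(a, b)} := by
    ext ⟨c, d⟩
    simp only [Finset.mem_filter, Finset.mem_univ, true_and, mul_right_inj,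
      Finset.mem_singleton, Prod.mk.injEq]
    constructor
    · rintro ⟨hcd, h⟩
      have h1 : Equiv.swap c d a = b := by rw [← h]; exact Equiv.swap_apply_left a b
      rw [Equiv.swap_apply_def] at h1
      split_ifs at h1 with h2 h3
      · exact ⟨h2.symm, h1⟩
      · subst h1 h3
        exact absurd hcd (not_lt.mpr hab.le)
      · exact absurd h1 hab.ne
    · rintro ⟨rfl, rfl⟩
      exact ⟨hab, rfl⟩
  rw [edgeWeight, h, Finset.sum_singleton]

open Classical in
/-- The saturated chains `id = u_0 ⋖ u_1 ⋖ ⋯ ⋖ u_ℓ = w` in the strong Bruhat order. As the Coxeter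
length grows by one in each step, all of them have `ℓ = ℓ(w)` steps. -/
noncomputable def saturatedChains (w : Equiv.Perm (Fin n)) :
    Finset (Fin (coxeterLength w + 1) → Equiv.Perm (Fin n)) :=
  Finset.univ.filter fun u =>
    u 0 = 1 ∧ u (Fin.last _) = w ∧
      ∀ k : Fin (coxeterLength w), BruhatCovers (u k.castSucc) (u k.succ)

/-- The dual Schubert polynomial `D^w = (1 / ℓ(w)!) ∑_C m_C`, where `C` runs over the saturated
chains from the identity to `w` and `m_C` is the product of the weights of the edges of `C`. -/
noncomputable def dualSchubert (w : Equiv.Perm (Fin n)) : MvPolynomial (Fin (n - 1)) ℝ :=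
  MvPolynomial.C (1 / ((coxeterLength w)! : ℝ)) *
    ∑ u ∈ saturatedChains w, ∏ k : Fin (coxeterLength w), edgeWeight (u k.castSucc) (u k.succ)

/-- The Newton polytope of a real polynomial: the convex hull of its exponent vectors. -/
def newtonPolytope {σ : Type*} (f : MvPolynomial σ ℝ) : Set (σ → ℝ) :=
  convexHull ℝ ((fun (α : σ →₀ ℕ) (i : σ) => (α i : ℝ)) '' (f.support : Set (σ →₀ ℕ)))

/-! ### Tilings of the staircase diagram -/

/-- The boxes `(i, j)` (row, column, both from `0`) of the Young diagram of staircase shape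
`(n - 1, n - 2, …, 1)`: row `i` consists of the columns `j < n - 1 - i`. -/
def staircase (n : ℕ) : Finset (ℕ × ℕ) :=
  (Finset.range n ×ˢ Finset.range n).filter fun c => c.1 + c.2 + 1 < n

theorem mem_staircase {n : ℕ} {c : ℕ × ℕ} : c ∈ staircase n ↔ c.1 + c.2 + 1 < n := by
  simp only [staircase, Finset.mem_filter, Finset.mem_product, Finset.mem_range]
  omega

/-- The number written in the box `c` of the staircase. In the numbering from `1`, the boxes of row
`i` carry from left to right the labels `(i, n), (i, n - 1), …, (i, i + 1)`; with numbering from `0`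
the box `c` has the label `(c.1, n - 1 - c.2)`. The entry is `1` if the label is an inversion of `w`,
and `0` otherwise. -/
def boxEntry (w : Equiv.Perm (Fin n)) (c : ℕ × ℕ) : ℕ :=
  if ∃ p ∈ inversions w, p.1.val = c.1 ∧ p.2.val = n - 1 - c.2 ∧ c.2 < n then 1 else 0

/-- A (nonempty) rectangle of boxes, with top left corner `p` and bottom right corner `q`. -/
def IsRectangle (R : Finset (ℕ × ℕ)) : Prop :=
  ∃ p q : ℕ × ℕ, p ≤ q ∧ R = Finset.Icc p q

/-- A tiling of the staircase of shape `(n - 1, …, 1)` by `n - 1` rectangles. -/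
structure RectangleTiling (n : ℕ) where
  tiles : Finset (Finset (ℕ × ℕ))
  isRectangle : ∀ R ∈ tiles, IsRectangle R
  pairwiseDisjoint : ∀ R ∈ tiles, ∀ S ∈ tiles, R ≠ S → Disjoint R S
  union_eq : tiles.biUnion id = staircase n
  card_eq : tiles.card = n - 1

/-- The row of the bottom right corner of a rectangle, i.e. the largest row index in it. -/
def bottomRow (R : Finset (ℕ × ℕ)) : ℕ := R.sup Prod.fst

/-- `α` is obtained from the tiling `T` as follows: list the tiles of `T` from top to bottom,
according to the rows of their bottom right corners (in which the sums are written), and let `α i`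
be the sum of the entries in the `i`-th tile. -/
def IsReading (w : Equiv.Perm (Fin n)) (T : RectangleTiling n) (α : Fin (n - 1) → ℕ) : Prop :=
  ∃ R : Fin (n - 1) → Finset (ℕ × ℕ),
    Set.range R = (T.tiles : Set (Finset (ℕ × ℕ))) ∧
    StrictMono (fun i => bottomRow (R i)) ∧
    ∀ i, α i = ∑ c ∈ R i, boxEntry w c

end DualSchubert

/-! The support of $D^w$ equals that of $\prod_{(a,b)\in \mathrm{Inv}(w)}(x_a+\cdots+x_{b-1})$.
Along a cover $u\lessdot v=ut_{ab}$ the inversions of $u$ match those of $v$ other than $(a,b)$,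
with intervals that only grow, so every chain product is coefficientwise at most the product for $w$
(`chain_prod_le`). A chain of left multiplications by simple transpositions attains it
(`exists_chain`), and nothing cancels (`support_dualSchubert`).

An exponent vector therefore records the choice, for each inversion $(a,b)$, of an index in
$[a,b-1]$. A vertex is the unique maximizer of a linear functional $c$ among the exponents, so each
inversion chooses an index where $c$ is largest on its interval.

A box of the staircase is an interval of indices, shrinking as one moves right or down, and the
corner boxes are the single indices. For an injective key, the boxes on whose interval $i$ is the
maximizer form a rectangle ending at corner $i$, and these rectangles tile the staircase
(`exists_tiling_of_key`). Conversely, in any tiling by $n-1$ rectangles each tile contains exactly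
one corner, and if the interval of a box of tile $i$ contains $j$, then tile $j$ has its top left
corner weakly below and to the right of that of tile $i$ (`topLeft_le_topLeft`). A key decreasing
along this order makes every tile a strict maximizer (`exists_strict_key`), so the reading is a
vertex. -/

namespace DualSchubert

variable {n : ℕ}

/-! ### Coefficientwise comparison of polynomials -/

section CoeffLE

variable {σ ι : Type*}

/-- The coefficientwise order on real polynomials. -/
def CoeffLE (p q : MvPolynomial σ ℝ) : Prop := ∀ m, p.coeff m ≤ q.coeff m

theorem CoeffLE.refl (p : MvPolynomial σ ℝ) : CoeffLE p p := fun _ => le_rfl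

theorem CoeffLE.trans {p q r : MvPolynomial σ ℝ} (h : CoeffLE p q) (h' : CoeffLE q r) :
    CoeffLE p r := fun m => (h m).trans (h' m)

theorem CoeffLE.mul {p q r s : MvPolynomial σ ℝ} (hp : CoeffLE 0 p) (hr : CoeffLE 0 r)
    (hpq : CoeffLE p q) (hrs : CoeffLE r s) : CoeffLE (p * r) (q * s) := by
  classical
  intro m
  rw [MvPolynomial.coeff_mul, MvPolynomial.coeff_mul]
  exact Finset.sum_le_sum fun x _ =>
    mul_le_mul (hpq _) (hrs _) (by simpa using hr x.2)
      (le_trans (by simpa using hp x.1) (hpq _))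

theorem coeffLE_zero_one : CoeffLE (0 : MvPolynomial σ ℝ) 1 := by
  classical
  intro m
  rw [MvPolynomial.coeff_zero, MvPolynomial.coeff_one]
  split_ifs <;> norm_num

theorem CoeffLE.mul_nonneg {p q : MvPolynomial σ ℝ} (hp : CoeffLE 0 p) (hq : CoeffLE 0 q) :
    CoeffLE 0 (p * q) := by
  simpa using CoeffLE.mul (CoeffLE.refl 0) (CoeffLE.refl 0) hp hq

theorem coeffLE_sum {s : Finset ι} {f : ι → MvPolynomial σ ℝ} (h : ∀ i ∈ s, CoeffLE 0 (f i)) :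
    CoeffLE 0 (∑ i ∈ s, f i) := by
  intro m
  rw [MvPolynomial.coeff_zero, MvPolynomial.coeff_sum]
  exact Finset.sum_nonneg fun i hi => by simpa using h i hi m

theorem coeffLE_prod_nonneg {s : Finset ι} {f : ι → MvPolynomial σ ℝ}
    (h : ∀ i ∈ s, CoeffLE 0 (f i)) : CoeffLE 0 (∏ i ∈ s, f i) := by
  classical
  induction s using Finset.induction_on with
  | empty => simpa using coeffLE_zero_one
  | insert a s ha ih =>
    rw [Finset.prod_insert ha]
    exact (h a (by simp)).mul_nonneg (ih fun i hi => h i (by simp [hi]))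

theorem coeffLE_prod {s : Finset ι} {f g : ι → MvPolynomial σ ℝ}
    (h : ∀ i ∈ s, CoeffLE 0 (f i)) (hfg : ∀ i ∈ s, CoeffLE (f i) (g i)) :
    CoeffLE (∏ i ∈ s, f i) (∏ i ∈ s, g i) := by
  classical
  induction s using Finset.induction_on with
  | empty => simpa using CoeffLE.refl _
  | insert a s ha ih =>
    rw [Finset.prod_insert ha, Finset.prod_insert ha]
    exact CoeffLE.mul (h a (by simp)) (coeffLE_prod_nonneg fun i hi => h i (by simp [hi]))
      (hfg a (by simp)) (ih (fun i hi => h i (by simp [hi])) fun i hi => hfg i (by simp [hi]))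

theorem coeffLE_zero_X (i : σ) : CoeffLE (0 : MvPolynomial σ ℝ) (MvPolynomial.X i) := by
  classical
  intro m
  rw [MvPolynomial.coeff_zero, MvPolynomial.coeff_X]
  split_ifs <;> norm_num

end CoeffLE

theorem coeffLE_zero_intervalForm (a b : Fin n) : CoeffLE 0 (intervalForm a b) :=
  coeffLE_sum fun i _ => coeffLE_zero_X i

theorem intervalForm_mono {a b a' b' : Fin n} (ha : a' ≤ a) (hb : b ≤ b') :
    CoeffLE (intervalForm a b) (intervalForm a' b') := by
  intro m
  rw [intervalForm, intervalForm, MvPolynomial.coeff_sum, MvPolynomial.coeff_sum]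
  refine Finset.sum_le_sum_of_subset_of_nonneg ?_ fun i _ _ => by
    simpa using coeffLE_zero_X i m
  intro i
  simp only [Finset.mem_filter, Finset.mem_univ, true_and]
  rw [Fin.le_def] at ha hb
  omega

/-! ### Inversions and the Coxeter length -/

theorem mem_inversions {w : Equiv.Perm (Fin n)} {p : Fin n × Fin n} :
    p ∈ inversions w ↔ p.1 < p.2 ∧ w p.2 < w p.1 := by
  simp [inversions]

theorem inversions_one : inversions (1 : Equiv.Perm (Fin n)) = ∅ := by
  ext p
  simp only [mem_inversions, Equiv.Perm.coe_one, id_eq, Finset.notMem_empty, iff_false]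
  exact fun h => lt_asymm h.1 h.2

theorem simpleTransposition_mul_self (k : Fin (n - 1)) :
    simpleTransposition k * simpleTransposition k = 1 :=
  Equiv.swap_mul_self _ _

theorem val_simpleTransposition (k : Fin (n - 1)) (x : Fin n) :
    (simpleTransposition k x).val =
      if x.val = k.val then k.val + 1 else if x.val = k.val + 1 then k.val else x.val := by
  rw [simpleTransposition, Equiv.swap_apply_def]
  simp only [Fin.ext_iff]
  split_ifs <;> rfl

theorem notMem_inversions {u : Equiv.Perm (Fin n)} {k : Fin (n - 1)} {a b : Fin n}
    (ha : (u a).val = k.val) (hb : (u b).val = k.val + 1) : (a, b) ∉ inversions u := by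
  rw [mem_inversions, Fin.lt_def (a := u _)]
  dsimp only
  omega

/-- Exchanging the adjacent values `k` and `k + 1` changes the relative order of no other pair of
values. -/
theorem inversions_simpleTransposition_mul {u : Equiv.Perm (Fin n)} {k : Fin (n - 1)} {a b : Fin n}
    (hab : a < b) (ha : (u a).val = k.val) (hb : (u b).val = k.val + 1) :
    inversions (simpleTransposition k * u) = insert (a, b) (inversions u) := by
  have key : ∀ (x y : Fin n) (m : ℕ), (u x).val = m → (u y).val = m → x = y :=
    fun x y m hx hy => u.injective (Fin.ext (hx.trans hy.symm))
  ext ⟨c, d⟩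
  simp only [mem_inversions, Finset.mem_insert, Prod.mk.injEq, Equiv.Perm.coe_mul,
    Function.comp_apply]
  rw [Fin.lt_def (a := simpleTransposition k _), Fin.lt_def (a := u d),
    val_simpleTransposition, val_simpleTransposition]
  have hca : c = a ↔ (u c).val = k.val := ⟨fun h => h ▸ ha, fun h => key _ _ _ h ha⟩
  have hcb : c = b ↔ (u c).val = k.val + 1 := ⟨fun h => h ▸ hb, fun h => key _ _ _ h hb⟩
  have hda : d = a ↔ (u d).val = k.val := ⟨fun h => h ▸ ha, fun h => key _ _ _ h ha⟩
  have hdb : d = b ↔ (u d).val = k.val + 1 := ⟨fun h => h ▸ hb, fun h => key _ _ _ h hb⟩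
  by_cases hcd : c < d
  · have hne : (u c).val ≠ (u d).val := fun h => hcd.ne (key _ _ _ h rfl)
    have : ¬ (c = b ∧ d = a) := by
      rintro ⟨rfl, rfl⟩
      exact lt_asymm hcd hab
    rw [hcb, hda] at this
    rw [hca, hdb]
    split_ifs <;> omega
  · have : ¬ (c = a ∧ d = b) := by
      rintro ⟨rfl, rfl⟩
      exact hcd hab
    simp [hcd, this]

theorem exists_descent {w : Equiv.Perm (Fin n)} (hw : w ≠ 1) :
    ∃ (k : Fin (n - 1)) (a b : Fin n), a < b ∧ (w a).val = k.val + 1 ∧ (w b).val = k.val := by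
  by_contra! h
  refine hw ?_
  -- Without descents the positions of successive values increase, and the only order automorphism
  -- of `Fin n` is the identity.
  have hmono : StrictMono (w⁻¹ : Equiv.Perm (Fin n)) := by
    obtain _ | m := n
    · exact fun i => i.elim0
    refine Fin.strictMono_iff_lt_succ.2 fun i => ?_
    by_contra hlt
    have hne : w⁻¹ i.castSucc ≠ w⁻¹ i.succ := fun e =>
      (Fin.castSucc_lt_succ (i := i)).ne (w⁻¹.injective e)
    exact h i _ _ (lt_of_le_of_ne (not_lt.1 hlt) hne.symm) (by simp) (by simp)
  have h1 : (w⁻¹ : Equiv.Perm (Fin n)) = 1 := by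
    ext x
    have := congrArg (fun e : Fin n ≃o Fin n => (e x).val)
      (Subsingleton.elim (hmono.orderIsoOfSurjective _ w⁻¹.surjective) (OrderIso.refl _))
    simpa using this
  simpa using h1

theorem inversions_simpleTransposition_mul_of_descent {w : Equiv.Perm (Fin n)} {k : Fin (n - 1)}
    {a b : Fin n} (hab : a < b) (ha : (w a).val = k.val + 1) (hb : (w b).val = k.val) :
    (a, b) ∉ inversions (simpleTransposition k * w) ∧
      inversions w = insert (a, b) (inversions (simpleTransposition k * w)) := by
  have ha' : ((simpleTransposition k * w) a).val = k.val := by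
    rw [Equiv.Perm.coe_mul, Function.comp_apply, val_simpleTransposition]
    simp [ha]
  have hb' : ((simpleTransposition k * w) b).val = k.val + 1 := by
    rw [Equiv.Perm.coe_mul, Function.comp_apply, val_simpleTransposition]
    simp [hb]
  refine ⟨notMem_inversions ha' hb', ?_⟩
  rw [← inversions_simpleTransposition_mul hab ha' hb', ← mul_assoc,
    simpleTransposition_mul_self, one_mul]

theorem card_inversions_simpleTransposition_mul_le (k : Fin (n - 1)) (u : Equiv.Perm (Fin n)) :
    (inversions (simpleTransposition k * u)).card ≤ (inversions u).card + 1 := by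
  obtain ⟨a, ha⟩ := u.surjective ⟨k.val, by omega⟩
  obtain ⟨b, hb⟩ := u.surjective ⟨k.val + 1, by omega⟩
  rw [Fin.ext_iff] at ha hb
  rcases lt_trichotomy a b with h | rfl | h
  · rw [inversions_simpleTransposition_mul h ha hb]
    exact Finset.card_insert_le _ _
  · simp only at ha hb
    omega
  · rw [(inversions_simpleTransposition_mul_of_descent h hb ha).2]
    exact (Finset.card_le_card (Finset.subset_insert _ _)).trans (Nat.le_succ _)

theorem card_inversions_prod_le (s : List (Fin (n - 1))) :
    (inversions (s.map simpleTransposition).prod).card ≤ s.length := by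
  induction s with
  | nil => simp [inversions_one]
  | cons k s ih =>
    rw [List.map_cons, List.prod_cons, List.length_cons]
    exact (card_inversions_simpleTransposition_mul_le k _).trans (by omega)

theorem eq_one_of_inversions_eq_empty {w : Equiv.Perm (Fin n)} (h : inversions w = ∅) : w = 1 := by
  by_contra hw
  obtain ⟨k, a, b, hab, ha, hb⟩ := exists_descent hw
  rw [(inversions_simpleTransposition_mul_of_descent hab ha hb).2] at h
  exact Finset.insert_ne_empty _ _ h

theorem exists_word (m : ℕ) (w : Equiv.Perm (Fin n)) (h : (inversions w).card = m) :
    ∃ s : List (Fin (n - 1)), s.length = m ∧ (s.map simpleTransposition).prod = w := by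
  induction m generalizing w with
  | zero => exact ⟨[], rfl, (eq_one_of_inversions_eq_empty (Finset.card_eq_zero.1 h)).symm⟩
  | succ m ih =>
    have hw : w ≠ 1 := by
      rintro rfl
      simp [inversions_one] at h
    obtain ⟨k, a, b, hab, ha, hb⟩ := exists_descent hw
    obtain ⟨h1, h2⟩ := inversions_simpleTransposition_mul_of_descent hab ha hb
    rw [h2, Finset.card_insert_of_notMem h1] at h
    obtain ⟨s, hs, hs'⟩ := ih _ (Nat.succ_injective h)
    refine ⟨k :: s, by simp [hs], ?_⟩
    rw [List.map_cons, List.prod_cons, hs', ← mul_assoc, simpleTransposition_mul_self, one_mul]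

theorem coxeterLength_eq_card_inversions (w : Equiv.Perm (Fin n)) :
    coxeterLength w = (inversions w).card := by
  refine le_antisymm (Nat.sInf_le (exists_word _ w rfl)) ?_
  refine le_csInf ⟨_, exists_word _ w rfl⟩ ?_
  rintro _ ⟨s, rfl, rfl⟩
  exact card_inversions_prod_le s

/-! ### The support of a dual Schubert polynomial -/

/-- The product of the linear forms `x_a + ⋯ + x_{b-1}` over the inversions `(a, b)` of `w`. -/
noncomputable def inversionProduct (w : Equiv.Perm (Fin n)) : MvPolynomial (Fin (n - 1)) ℝ :=
  ∏ p ∈ inversions w, intervalForm p.1 p.2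

theorem coeffLE_zero_edgeWeight (u v : Equiv.Perm (Fin n)) : CoeffLE 0 (edgeWeight u v) :=
  coeffLE_sum fun _ _ => coeffLE_zero_intervalForm _ _

/-- An injection of the inversions of `u` into those of `u * swap a b` other than `(a, b)`, which
enlarges intervals. -/
noncomputable def transportInversion (u : Equiv.Perm (Fin n)) (a b : Fin n) (p : Fin n × Fin n) :
    Fin n × Fin n :=
  if p ∈ inversions (u * Equiv.swap a b) then p else (Equiv.swap a b p.1, Equiv.swap a b p.2)

/-- An inversion of `u` can be lost only if it is `(b, d)` or `(c, a)`; it then moves to `(a, d)` or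
`(c, b)`, a longer interval. -/
theorem transportInversion_spec {u : Equiv.Perm (Fin n)} {a b : Fin n} (hab : a < b)
    (hu : u a < u b) {p : Fin n × Fin n} (hp : p ∈ inversions u) :
    transportInversion u a b p ∈ (inversions (u * Equiv.swap a b)).erase (a, b) ∧
      (transportInversion u a b p).1 ≤ p.1 ∧ p.2 ≤ (transportInversion u a b p).2 := by
  obtain ⟨c, d⟩ := p
  simp only [transportInversion, mem_inversions, Equiv.Perm.coe_mul, Function.comp_apply,
    Finset.mem_erase, Equiv.swap_apply_def] at hp ⊢
  grind

/-- A collision would need, say, both `(a, d)` and `(b, d)` inverted in `u`, but then `(b, d)` stays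
an inversion and is not moved. -/
theorem transportInversion_injOn {u : Equiv.Perm (Fin n)} {a b : Fin n} (hab : a < b)
    (hu : u a < u b) :
    Set.InjOn (transportInversion u a b) (inversions u : Set (Fin n × Fin n)) := by
  rintro ⟨c, d⟩ hp ⟨c', d'⟩ hq h
  have hinj : ∀ x y, u x = u y → x = y := fun x y => (u.injective ·)
  simp only [Finset.mem_coe, transportInversion, mem_inversions, Equiv.Perm.coe_mul,
    Function.comp_apply, Equiv.swap_apply_def] at hp hq h
  grind

theorem BruhatCovers.edgeWeight_mul_inversionProduct_le {u v : Equiv.Perm (Fin n)}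
    (h : BruhatCovers u v) :
    CoeffLE (inversionProduct u * edgeWeight u v) (inversionProduct v) := by
  obtain ⟨⟨a, b, hab, rfl⟩, hl⟩ := h
  rw [edgeWeight_mul_swap u hab]
  rw [coxeterLength_eq_card_inversions, coxeterLength_eq_card_inversions] at hl
  -- Otherwise the injection, applied from `u * swap a b` back to `u`, would show that the length
  -- does not grow.
  have hu : u a < u b := by
    by_contra hlt
    have hlt' : u b < u a := lt_of_le_of_ne (not_lt.1 hlt) fun e => hab.ne' (u.injective e)
    have hle : (inversions (u * Equiv.swap a b)).card ≤
        (inversions (u * Equiv.swap a b * Equiv.swap a b)).card :=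
      (Finset.card_le_card_of_injOn _ (fun p hp => (transportInversion_spec hab
        (by simpa using hlt') hp).1) (transportInversion_injOn hab (by simpa using hlt'))).trans
        (Finset.card_erase_le)
    rw [mul_assoc, Equiv.swap_mul_self, mul_one] at hle
    omega
  have hmem : (a, b) ∈ inversions (u * Equiv.swap a b) := by
    simp [mem_inversions, hab, hu]
  -- The length grows by exactly one, so the injection is onto the inversions other than `(a, b)`.
  have himage : (inversions u).image (transportInversion u a b) =
      (inversions (u * Equiv.swap a b)).erase (a, b) := by
    refine Finset.eq_of_subset_of_card_le ?_ ?_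
    · exact Finset.image_subset_iff.2 fun p hp => (transportInversion_spec hab hu hp).1
    · rw [Finset.card_image_of_injOn (transportInversion_injOn hab hu),
        Finset.card_erase_of_mem hmem]
      omega
  rw [inversionProduct, inversionProduct, ← Finset.prod_erase_mul _ _ hmem, ← himage,
    Finset.prod_image (transportInversion_injOn hab hu)]
  refine CoeffLE.mul (coeffLE_prod_nonneg fun _ _ => coeffLE_zero_intervalForm _ _)
    (coeffLE_zero_intervalForm _ _) (coeffLE_prod (fun _ _ => coeffLE_zero_intervalForm _ _)
    fun p hp => ?_) (CoeffLE.refl _)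
  exact intervalForm_mono (transportInversion_spec hab hu hp).2.1
    (transportInversion_spec hab hu hp).2.2

theorem chain_prod_le (N : ℕ) (u : Fin (N + 1) → Equiv.Perm (Fin n)) (h0 : u 0 = 1)
    (h : ∀ k : Fin N, BruhatCovers (u k.castSucc) (u k.succ)) :
    CoeffLE (∏ k : Fin N, edgeWeight (u k.castSucc) (u k.succ))
      (inversionProduct (u (Fin.last N))) := by
  induction N with
  | zero => simpa [h0, inversionProduct, inversions_one] using CoeffLE.refl _
  | succ N ih =>
    rw [Fin.prod_univ_castSucc]
    refine CoeffLE.trans ?_ (h (Fin.last N)).edgeWeight_mul_inversionProduct_le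
    exact CoeffLE.mul (coeffLE_prod_nonneg fun _ _ => coeffLE_zero_edgeWeight _ _)
      (coeffLE_zero_edgeWeight _ _) (ih (fun k => u k.castSucc) h0 fun k => h k.castSucc)
      (CoeffLE.refl _)

/-- In a weak order chain each step adds one inversion, whose linear form is the weight of the step,
and leaves the others unchanged. -/
theorem exists_chain (m : ℕ) (w : Equiv.Perm (Fin n)) (hm : (inversions w).card = m) :
    ∃ u : Fin (m + 1) → Equiv.Perm (Fin n), u 0 = 1 ∧ u (Fin.last m) = w ∧
      (∀ k : Fin m, BruhatCovers (u k.castSucc) (u k.succ)) ∧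
      ∏ k : Fin m, edgeWeight (u k.castSucc) (u k.succ) = inversionProduct w := by
  induction m generalizing w with
  | zero =>
    obtain rfl := eq_one_of_inversions_eq_empty (Finset.card_eq_zero.1 hm)
    exact ⟨fun _ => 1, rfl, rfl, fun k => k.elim0, by simp [inversionProduct, inversions_one]⟩
  | succ m ih =>
    have hw : w ≠ 1 := by
      rintro rfl
      simp [inversions_one] at hm
    obtain ⟨k, a, b, hab, ha, hb⟩ := exists_descent hw
    obtain ⟨h1, h2⟩ := inversions_simpleTransposition_mul_of_descent hab ha hb
    have hm' := hm
    rw [h2, Finset.card_insert_of_notMem h1] at hm'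
    have hm'' := Nat.succ_injective hm'
    obtain ⟨u, hu0, hul, hu, hprod⟩ := ih _ hm''
    -- Exchanging two values on the left is exchanging on the right the positions that hold them.
    have hswap : w = simpleTransposition k * w * Equiv.swap a b := by
      have hwa : w a = ⟨k.val + 1, by omega⟩ := Fin.ext ha
      have hwb : w b = ⟨k.val, by omega⟩ := Fin.ext hb
      rw [mul_assoc, Equiv.mul_swap_eq_swap_mul, hwa, hwb, Equiv.swap_comm, ← mul_assoc]
      exact (by rw [simpleTransposition, Equiv.swap_mul_self, one_mul])
    refine ⟨Fin.snoc u w, ?_, by simp, ?_, ?_⟩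
    · rw [← Fin.castSucc_zero, Fin.snoc_castSucc, hu0]
    · intro j
      refine Fin.lastCases ?_ (fun j => ?_) j
      · rw [Fin.snoc_castSucc, Fin.succ_last, Fin.snoc_last, hul]
        refine ⟨⟨a, b, hab, hswap⟩, ?_⟩
        rw [coxeterLength_eq_card_inversions, coxeterLength_eq_card_inversions, hm, hm'']
      · rw [Fin.snoc_castSucc, Fin.succ_castSucc, Fin.snoc_castSucc]
        exact hu j
    · rw [Fin.prod_univ_castSucc]
      simp only [Fin.snoc_castSucc, Fin.succ_last, Fin.snoc_last, Fin.succ_castSucc, hul, hprod]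
      have he : edgeWeight (simpleTransposition k * w) w = intervalForm a b := by
        have := edgeWeight_mul_swap (simpleTransposition k * w) hab
        rwa [← hswap] at this
      rw [he, inversionProduct, inversionProduct, h2, Finset.prod_insert h1, mul_comm]

theorem support_dualSchubert (w : Equiv.Perm (Fin n)) :
    (dualSchubert w).support = (inversionProduct w).support := by
  have hnonneg : ∀ u : Fin (coxeterLength w + 1) → Equiv.Perm (Fin n),
      CoeffLE 0 (∏ k : Fin (coxeterLength w), edgeWeight (u k.castSucc) (u k.succ)) :=
    fun u => coeffLE_prod_nonneg fun _ _ => coeffLE_zero_edgeWeight _ _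
  have hfac : (1 / ((coxeterLength w)! : ℝ)) ≠ 0 := by positivity
  ext m
  rw [MvPolynomial.mem_support_iff, MvPolynomial.mem_support_iff, dualSchubert,
    MvPolynomial.coeff_C_mul, MvPolynomial.coeff_sum, mul_ne_zero_iff, and_iff_right hfac,
    not_iff_not, Finset.sum_eq_zero_iff_of_nonneg fun u _ => by simpa using hnonneg u m]
  constructor
  · intro h
    obtain ⟨u, h0, hl, hc, hp⟩ := exists_chain _ w (coxeterLength_eq_card_inversions w).symm
    rw [← hp]
    exact h u (by simp [saturatedChains, h0, hl, hc])
  · intro h u hu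
    simp only [saturatedChains, Finset.mem_filter, Finset.mem_univ, true_and] at hu
    refine le_antisymm ?_ (by simpa using hnonneg u m)
    rw [← h]
    conv_rhs => rw [← hu.2.1]
    exact chain_prod_le _ u hu.1 hu.2.2 m

/-! ### Exponents of products of interval forms -/

theorem mem_support_mul_iff {σ : Type*} {p q : MvPolynomial σ ℝ} (hp : CoeffLE 0 p)
    (hq : CoeffLE 0 q) {m : σ →₀ ℕ} :
    m ∈ (p * q).support ↔ ∃ a ∈ p.support, ∃ b ∈ q.support, a + b = m := by
  classical
  rw [MvPolynomial.mem_support_iff, MvPolynomial.coeff_mul, Ne, Finset.sum_eq_zero_iff_of_nonneg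
    fun x _ => mul_nonneg (by simpa using hp x.1) (by simpa using hq x.2)]
  simp only [mul_eq_zero, not_forall, not_or, Prod.exists,
    MvPolynomial.mem_support_iff, exists_prop]
  constructor
  · rintro ⟨a, b, h, ha, hb⟩
    exact ⟨a, ha, b, hb, Finset.HasAntidiagonal.mem_antidiagonal.1 h⟩
  · rintro ⟨a, ha, b, hb, h⟩
    exact ⟨a, b, Finset.HasAntidiagonal.mem_antidiagonal.2 h, ha, hb⟩

theorem mem_support_intervalForm {a b : Fin n} {m : Fin (n - 1) →₀ ℕ} :
    m ∈ (intervalForm a b).support ↔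
      ∃ i : Fin (n - 1), (a.val ≤ i.val ∧ i.val < b.val) ∧ m = Finsupp.single i 1 := by
  classical
  rw [MvPolynomial.mem_support_iff, intervalForm, MvPolynomial.coeff_sum, Ne,
    Finset.sum_eq_zero_iff_of_nonneg fun i _ => by simpa using coeffLE_zero_X i m]
  simp [MvPolynomial.coeff_X, eq_comm, and_assoc]

theorem mem_support_prod_intervalForm [Nonempty (Fin (n - 1))]
    {S : Finset (Fin n × Fin n)} {m : Fin (n - 1) →₀ ℕ} :
    m ∈ (∏ p ∈ S, intervalForm p.1 p.2).support ↔
      ∃ g : Fin n × Fin n → Fin (n - 1),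
        (∀ p ∈ S, p.1.val ≤ (g p).val ∧ (g p).val < p.2.val) ∧
          m = ∑ p ∈ S, Finsupp.single (g p) 1 := by
  classical
  induction S using Finset.induction_on generalizing m with
  | empty =>
    simp
  | insert q S hq ih =>
    rw [Finset.prod_insert hq, mem_support_mul_iff (coeffLE_zero_intervalForm _ _)
      (coeffLE_prod_nonneg fun _ _ => coeffLE_zero_intervalForm _ _)]
    simp only [Finset.sum_insert hq]
    constructor
    · rintro ⟨a, ha, b, hb, rfl⟩
      obtain ⟨i, hi, rfl⟩ := mem_support_intervalForm.1 ha
      obtain ⟨g, hg, rfl⟩ := ih.1 hb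
      have hne : ∀ p ∈ S, p ≠ q := fun p hp h => hq (h ▸ hp)
      refine ⟨Function.update g q i, fun p hp => ?_, ?_⟩
      · rcases Finset.mem_insert.1 hp with rfl | hp
        · simpa using hi
        · simpa [hne p hp] using hg p hp
      · rw [Function.update_self]
        congr 1
        exact Finset.sum_congr rfl fun p hp => by rw [Function.update_of_ne (hne p hp)]
    · rintro ⟨g, hg, rfl⟩
      exact ⟨_, mem_support_intervalForm.2 ⟨g q, hg q (by simp), rfl⟩, _,
        ih.2 ⟨g, fun p hp => hg p (by simp [hp]), rfl⟩, rfl⟩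

/-! ### Extreme points of the convex hull of a finite set -/

/-- An extreme point lies outside the closed hull of the other points, so Hahn-Banach separates it;
conversely, a unique maximizer is exposed. -/
theorem mem_extremePoints_convexHull_iff {ι : Type*} [Fintype ι] {A : Set (ι → ℝ)}
    (hA : A.Finite) {v : ι → ℝ} :
    v ∈ (convexHull ℝ A).extremePoints ℝ ↔
      v ∈ A ∧ ∃ c : ι → ℝ, ∀ y ∈ A, y ≠ v → ∑ i, c i * y i < ∑ i, c i * v i := by
  classical
  constructor
  · intro h
    refine ⟨extremePoints_convexHull_subset h, ?_⟩
    have hv : v ∉ convexHull ℝ (A \ {v}) := fun hmem =>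
      ((convex_convexHull ℝ A).mem_extremePoints_iff_mem_sdiff_convexHull_sdiff.1 h).2
        (convexHull_mono (Set.sdiff_subset_sdiff_left (subset_convexHull ℝ A)) hmem)
    obtain ⟨f, u, hf, hu⟩ := geometric_hahn_banach_closed_point (convex_convexHull ℝ _)
      ((hA.sdiff (t := {v})).isClosed_convexHull ℝ) hv
    refine ⟨fun i => f fun j => if i = j then 1 else 0, fun y hy hne => ?_⟩
    have hsum : ∀ x : ι → ℝ, ∑ i, (f fun j => if i = j then 1 else 0) * x i = f x := by
      intro x
      have := LinearMap.pi_apply_eq_sum_univ f.toLinearMap x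
      simp only [ContinuousLinearMap.coe_coe, smul_eq_mul] at this
      rw [this]
      exact Finset.sum_congr rfl fun i _ => mul_comm _ _
    rw [hsum, hsum]
    exact (hf y (subset_convexHull ℝ _ ⟨hy, hne⟩)).trans hu
  · rintro ⟨hv, c, hc⟩
    have hlt : ∀ y ∈ convexHull ℝ A, y = v ∨ ∑ i, c i * y i < ∑ i, c i * v i := by
      have hlin : ∀ (a b : ℝ) (x y : ι → ℝ), ∑ i, c i * (a • x + b • y) i =
          a * ∑ i, c i * x i + b * ∑ i, c i * y i := by
        intro a b x y
        rw [Finset.mul_sum, Finset.mul_sum, ← Finset.sum_add_distrib]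
        refine Finset.sum_congr rfl fun i _ => ?_
        simp only [Pi.add_apply, Pi.smul_apply, smul_eq_mul]
        ring
      refine fun y hy => convexHull_min (t := {y | y = v ∨ ∑ i, c i * y i < ∑ i, c i * v i})
        (fun y hy => or_iff_not_imp_left.2 (hc y hy)) ?_ hy
      rw [convex_iff_forall_pos]
      rintro x hx y hy a b ha hb hab
      rw [Set.mem_ofPred_eq] at hx hy ⊢
      rw [hlin]
      rcases hx with rfl | hx <;> rcases hy with rfl | hy
      · left
        rw [← add_smul, hab, one_smul]
      all_goals
        right
        obtain rfl : b = 1 - a := by linarith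
        nlinarith
    refine exposedPoints_subset_extremePoints ⟨subset_convexHull ℝ A hv,
      ∑ i : ι, c i • (ContinuousLinearMap.proj i : (ι → ℝ) →L[ℝ] ℝ), fun y hy => ?_⟩
    simp only [sum_apply, smul_apply,
      ContinuousLinearMap.proj_apply, smul_eq_mul]
    rcases hlt y hy with rfl | h
    · exact ⟨le_rfl, fun _ => rfl⟩
    · exact ⟨h.le, fun h' => absurd h' (not_le.2 h)⟩

/-- The vector counting how often each index is chosen by `g` on `S`. -/
def countVector {κ ι : Type*} [DecidableEq ι] (S : Finset κ) (g : κ → ι) (i : ι) : ℕ :=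
  ∑ p ∈ S, if g p = i then 1 else 0

theorem sum_mul_countVector {κ ι : Type*} [DecidableEq ι] [Fintype ι] (S : Finset κ) (g : κ → ι)
    (c : ι → ℝ) : ∑ i, c i * (countVector S g i : ℝ) = ∑ p ∈ S, c (g p) := by
  simp only [countVector, Nat.cast_sum, Finset.mul_sum]
  rw [Finset.sum_comm]
  exact Finset.sum_congr rfl fun p _ => by simp

theorem exponents_dualSchubert [Nonempty (Fin (n - 1))] (w : Equiv.Perm (Fin n)) :
    (fun (α : Fin (n - 1) →₀ ℕ) (i : Fin (n - 1)) => (α i : ℝ)) ''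
        ((dualSchubert w).support : Set (Fin (n - 1) →₀ ℕ)) =
      {v | ∃ g : Fin n × Fin n → Fin (n - 1),
        (∀ p ∈ inversions w, p.1.val ≤ (g p).val ∧ (g p).val < p.2.val) ∧
          v = fun i => (countVector (inversions w) g i : ℝ)} := by
  have hcount : ∀ g : Fin n × Fin n → Fin (n - 1), ∀ i,
      (∑ p ∈ inversions w, Finsupp.single (g p) 1 : Fin (n - 1) →₀ ℕ) i =
        countVector (inversions w) g i := by
    intro g i
    rw [Finsupp.finsetSum_apply, countVector]
    exact Finset.sum_congr rfl fun p _ => by rw [Finsupp.single_apply]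
  rw [support_dualSchubert, inversionProduct]
  ext v
  simp only [Set.mem_image, Finset.mem_coe, mem_support_prod_intervalForm, Set.mem_ofPred_eq]
  constructor
  · rintro ⟨_, ⟨g, hg, rfl⟩, rfl⟩
    exact ⟨g, hg, by simp only [hcount]⟩
  · rintro ⟨g, hg, rfl⟩
    exact ⟨_, ⟨g, hg, rfl⟩, by simp only [hcount]⟩

/-! ### Tilings by `n - 1` rectangles -/

/-- The corner box in row `i` of the staircase. -/
def corner (i : Fin (n - 1)) : ℕ × ℕ := (i.val, n - 2 - i.val)

theorem corner_mem_staircase (i : Fin (n - 1)) : corner i ∈ staircase n := by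
  rw [mem_staircase, corner]
  dsimp only
  omega

namespace RectangleTiling

variable (T : RectangleTiling n)

theorem exists_tile {c : ℕ × ℕ} (hc : c ∈ staircase n) : ∃ R ∈ T.tiles, c ∈ R := by
  rw [← T.union_eq] at hc
  simpa using hc

/-- The tile containing the corner box in row `i`. -/
noncomputable def tile (i : Fin (n - 1)) : Finset (ℕ × ℕ) :=
  (T.exists_tile (corner_mem_staircase i)).choose

theorem tile_mem (i : Fin (n - 1)) : T.tile i ∈ T.tiles :=
  (T.exists_tile (corner_mem_staircase i)).choose_spec.1

theorem corner_mem_tile (i : Fin (n - 1)) : corner i ∈ T.tile i :=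
  (T.exists_tile (corner_mem_staircase i)).choose_spec.2

theorem eq_of_mem {R S : Finset (ℕ × ℕ)} (hR : R ∈ T.tiles) (hS : S ∈ T.tiles) {c : ℕ × ℕ}
    (hcR : c ∈ R) (hcS : c ∈ S) : R = S := by
  by_contra h
  exact Finset.disjoint_left.1 (T.pairwiseDisjoint R hR S hS h) hcR hcS

/-- A corner box is maximal in the staircase, so it must be the bottom right box of its tile. -/
theorem exists_tile_eq_Icc (i : Fin (n - 1)) :
    ∃ p, p ≤ corner i ∧ T.tile i = Finset.Icc p (corner i) := by
  obtain ⟨p, q, hpq, hR⟩ := T.isRectangle _ (T.tile_mem i)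
  have hq : q ∈ staircase n := by
    rw [← T.union_eq, Finset.mem_biUnion]
    exact ⟨_, T.tile_mem i, by simp [hR, hpq]⟩
  have hc := T.corner_mem_tile i
  rw [hR, Finset.mem_Icc] at hc
  have hqc : q = corner i := by
    rw [mem_staircase] at hq
    have := hc.2
    simp only [Prod.le_def, corner] at this
    ext <;> simp only [corner] <;> omega
  subst hqc
  exact ⟨p, hpq, hR⟩

/-- The top left corner of the tile containing the corner box in row `i`. -/
noncomputable def topLeft (i : Fin (n - 1)) : ℕ × ℕ := (T.exists_tile_eq_Icc i).choose

theorem topLeft_le (i : Fin (n - 1)) : T.topLeft i ≤ corner i :=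
  (T.exists_tile_eq_Icc i).choose_spec.1

theorem tile_eq_Icc (i : Fin (n - 1)) : T.tile i = Finset.Icc (T.topLeft i) (corner i) :=
  (T.exists_tile_eq_Icc i).choose_spec.2

theorem topLeft_mem_tile (i : Fin (n - 1)) : T.topLeft i ∈ T.tile i := by
  rw [tile_eq_Icc]
  exact Finset.mem_Icc.2 ⟨le_rfl, T.topLeft_le i⟩

theorem mem_tile {i : Fin (n - 1)} {c : ℕ × ℕ} : c ∈ T.tile i ↔
    ((T.topLeft i).1 ≤ c.1 ∧ (T.topLeft i).2 ≤ c.2) ∧ c.1 ≤ i.val ∧ c.2 ≤ n - 2 - i.val := by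
  rw [tile_eq_Icc, Finset.mem_Icc, Prod.le_def, Prod.le_def, corner]

theorem bottomRow_tile (i : Fin (n - 1)) : bottomRow (T.tile i) = i.val := by
  refine le_antisymm (Finset.sup_le fun c hc => ((T.mem_tile).1 hc).2.1) ?_
  exact Finset.le_sup (f := Prod.fst) (T.corner_mem_tile i)

theorem tile_injective : Function.Injective T.tile := by
  intro i j h
  have := congrArg bottomRow h
  rw [bottomRow_tile, bottomRow_tile] at this
  exact Fin.ext this

/-- The `n - 1` corners lie in distinct tiles and there are only `n - 1` tiles. -/
theorem range_tile : Set.range T.tile = (T.tiles : Set (Finset (ℕ × ℕ))) := by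
  classical
  have : Finset.univ.image T.tile = T.tiles := by
    refine Finset.eq_of_subset_of_card_le ?_ ?_
    · exact Finset.image_subset_iff.2 fun i _ => T.tile_mem i
    · rw [Finset.card_image_of_injective _ T.tile_injective, T.card_eq, Finset.card_univ,
        Fintype.card_fin]
  rw [← this]
  simp

theorem eq_of_mem_tile {i j : Fin (n - 1)} {c : ℕ × ℕ} (hi : c ∈ T.tile i) (hj : c ∈ T.tile j) :
    i = j :=
  T.tile_injective (T.eq_of_mem (T.tile_mem i) (T.tile_mem j) hi hj)

theorem exists_mem_tile {c : ℕ × ℕ} (hc : c ∈ staircase n) : ∃ i, c ∈ T.tile i := by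
  obtain ⟨R, hR, hcR⟩ := T.exists_tile hc
  rw [← Finset.mem_coe, ← T.range_tile] at hR
  obtain ⟨i, rfl⟩ := hR
  exact ⟨i, hcR⟩

theorem isReading_iff (w : Equiv.Perm (Fin n)) (α : Fin (n - 1) → ℕ) :
    IsReading w T α ↔ ∀ i, α i = ∑ c ∈ T.tile i, boxEntry w c := by
  have hmono : StrictMono fun i => bottomRow (T.tile i) := by
    intro i j hij
    simpa only [bottomRow_tile] using Fin.lt_def.1 hij
  constructor
  · rintro ⟨R, hR, hRmono, hα⟩
    -- Two strictly increasing enumerations of the same set of bottom rows coincide.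
    have hrow := (hRmono.range_inj hmono).1 (by
      rw [← Function.comp_def bottomRow R, ← Function.comp_def bottomRow T.tile, Set.range_comp,
        Set.range_comp, hR, range_tile])
    have hRT : R = T.tile := by
      funext i
      have hi : R i ∈ Set.range T.tile := by
        rw [range_tile, ← hR]
        exact ⟨i, rfl⟩
      obtain ⟨j, hj⟩ := hi
      have := congrFun hrow i
      simp only [← hj, bottomRow_tile] at this
      rw [← hj, Fin.ext this]
    exact fun i => hRT ▸ hα i
  · exact fun h => ⟨T.tile, T.range_tile, hmono, h⟩

/-! ### Relative position of the tiles -/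

/-- Tile `i` meets the column of corner `j`; were tile `j` to reach up to row `i`, the two would
overlap in that column. `lt_topLeft_snd` is the transposed statement. -/
theorem lt_topLeft_fst {i j : Fin (n - 1)} (hij : i < j) (h : j.val + (T.topLeft i).2 + 2 ≤ n) :
    i.val < (T.topLeft j).1 := by
  by_contra! hle
  have hi := T.topLeft_le i
  have hj := T.topLeft_le j
  simp only [Prod.le_def, corner] at hi hj
  rw [Fin.lt_def] at hij
  refine hij.ne (congrArg Fin.val (T.eq_of_mem_tile
    (c := (max (T.topLeft i).1 (T.topLeft j).1, n - 2 - j.val)) ?_ ?_)) <;>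
  · rw [mem_tile]
    dsimp only
    omega

theorem lt_topLeft_snd {i j : Fin (n - 1)} (hji : j < i) (h : (T.topLeft i).1 ≤ j.val) :
    n < i.val + (T.topLeft j).2 + 2 := by
  by_contra! hle
  have hi := T.topLeft_le i
  have hj := T.topLeft_le j
  simp only [Prod.le_def, corner] at hi hj
  rw [Fin.lt_def] at hji
  refine hji.ne' (congrArg Fin.val (T.eq_of_mem_tile
    (c := (j.val, max (T.topLeft i).2 (T.topLeft j).2)) ?_ ?_)) <;>
  · rw [mem_tile]
    dsimp only
    omega

theorem topLeft_le_topLeft {i j : Fin (n - 1)} (h1 : (T.topLeft i).1 ≤ j.val)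
    (h2 : j.val + (T.topLeft i).2 + 2 ≤ n) : T.topLeft i ≤ T.topLeft j := by
  have hi := T.topLeft_le i
  have hj := T.topLeft_le j
  simp only [Prod.le_def, corner] at hi hj ⊢
  rcases lt_trichotomy i j with hij | rfl | hji
  · have h3 := T.lt_topLeft_fst hij h2
    rw [Fin.lt_def] at hij
    refine ⟨by omega, ?_⟩
    by_contra! hlt
    -- If tile `j` began to the left of tile `i`, the tile `k` of this box would have its corner
    -- below row `i`. It cannot extend to the left column of tile `i`, so `k > j`; but then it must
    -- start below row `j`, although it meets row `i`.
    obtain ⟨k, hk⟩ := T.exists_mem_tile (c := (i.val, (T.topLeft j).2))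
      (mem_staircase.2 (by dsimp only; omega))
    rw [mem_tile] at hk
    dsimp only at hk
    have hki : k.val ≠ i.val := by
      intro h
      rw [Fin.ext h] at hk
      omega
    have h4 : ¬ k.val + (T.topLeft i).2 + 2 ≤ n := fun h => by
      have := T.lt_topLeft_fst (i := i) (j := k) (Fin.lt_def.2 (by omega)) h
      omega
    have := T.lt_topLeft_fst (i := j) (j := k) (Fin.lt_def.2 (by omega)) (by omega)
    omega
  · exact ⟨le_rfl, le_rfl⟩
  · have h3 := T.lt_topLeft_snd hji h1
    rw [Fin.lt_def] at hji
    refine ⟨?_, by omega⟩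
    by_contra! hlt
    obtain ⟨k, hk⟩ := T.exists_mem_tile (c := ((T.topLeft j).1, n - 2 - i.val))
      (mem_staircase.2 (by dsimp only; omega))
    rw [mem_tile] at hk
    dsimp only at hk
    have hki : k.val ≠ i.val := by
      intro h
      rw [Fin.ext h] at hk
      omega
    have h4 : ¬ (T.topLeft i).1 ≤ k.val := fun h => by
      have := T.lt_topLeft_snd (i := i) (j := k) (Fin.lt_def.2 (by omega)) h
      omega
    have := T.lt_topLeft_snd (i := j) (j := k) (Fin.lt_def.2 (by omega)) (by omega)
    omega

/-- Minus the coordinate sum is strictly decreasing in the product order, and distinct tiles have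
distinct top left corners. -/
theorem exists_strict_key : ∃ key : Fin (n - 1) → ℝ, ∀ i, ∀ c ∈ T.tile i, ∀ j, j ≠ i →
    c.1 ≤ j.val → j.val + c.2 + 2 ≤ n → key j < key i := by
  refine ⟨fun i => -(((T.topLeft i).1 + (T.topLeft i).2 : ℕ) : ℝ), fun i c hc j hne h1 h2 => ?_⟩
  rw [mem_tile] at hc
  have hle := T.topLeft_le_topLeft (i := i) (j := j) (by omega) (by omega)
  have hne' : T.topLeft i ≠ T.topLeft j := fun h =>
    hne (T.eq_of_mem_tile (h ▸ T.topLeft_mem_tile j) (T.topLeft_mem_tile i))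
  rw [neg_lt_neg_iff, Nat.cast_lt]
  rw [Prod.le_def] at hle
  rw [Ne, Prod.ext_iff] at hne'
  omega

end RectangleTiling

/-- A tiling in which each box lies in the tile of the index maximizing `key` over the interval
of the box. -/
theorem exists_tiling_of_key {L : Type*} [LinearOrder L] (key : Fin (n - 1) → L)
    (hkey : Function.Injective key) :
    ∃ T : RectangleTiling n, ∀ i, ∀ c ∈ T.tile i, ∀ j, c.1 ≤ j.val → j.val + c.2 + 2 ≤ n →
      key j ≤ key i := by
  classical
  have hrow : ∀ i : Fin (n - 1), ∃ a, ∀ j, a ≤ j.val → j ≤ i → key j ≤ key i := fun i =>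
    ⟨i.val, fun j h1 h2 => (le_antisymm h2 (Fin.le_def.2 h1) ▸ le_rfl)⟩
  have hcol : ∀ i : Fin (n - 1), ∃ b, ∀ j, i ≤ j → j.val + b + 2 ≤ n → key j ≤ key i := fun i =>
    ⟨n - 2 - i.val, fun j h1 h2 => by
      rw [Fin.le_def] at h1
      rw [show j = i from Fin.ext (by omega)]⟩
  -- The rectangle extends up and left as far as `key i` stays maximal; the conditions on indices
  -- before and after `i` are independent, hence a rectangle.
  let R : Fin (n - 1) → Finset (ℕ × ℕ) := fun i =>
    Finset.Icc (Nat.find (hrow i), Nat.find (hcol i)) (corner i)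
  have hR : ∀ i c, c ∈ R i ↔ (c.1 ≤ i.val ∧ i.val + c.2 + 2 ≤ n) ∧
      ∀ j : Fin (n - 1), c.1 ≤ j.val → j.val + c.2 + 2 ≤ n → key j ≤ key i := by
    intro i c
    simp only [R, Finset.mem_Icc, Prod.le_def, corner]
    constructor
    · rintro ⟨⟨h1, h2⟩, h3, h4⟩
      refine ⟨⟨h3, by omega⟩, fun j h5 h6 => ?_⟩
      rcases le_total j i with h | h
      · exact Nat.find_spec (hrow i) j (h1.trans h5) h
      · exact Nat.find_spec (hcol i) j h (by omega)
    · rintro ⟨⟨h1, h2⟩, h3⟩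
      refine ⟨⟨Nat.find_min' _ fun j h4 h5 => h3 j h4 ?_, Nat.find_min' _ fun j h4 h5 =>
        h3 j ?_ h5⟩, h1, by omega⟩
      · rw [Fin.le_def] at h5
        omega
      · rw [Fin.le_def] at h4
        omega
  have hcorner : ∀ i, corner i ∈ R i := by
    intro i
    rw [hR, corner]
    dsimp only
    refine ⟨by omega, fun j h1 h2 => ?_⟩
    rw [show j = i from Fin.ext (by omega)]
  have heq : ∀ i j c, c ∈ R i → c ∈ R j → i = j := by
    intro i j c hi hj
    rw [hR] at hi hj
    exact hkey (le_antisymm (hj.2 i hi.1.1 hi.1.2) (hi.2 j hj.1.1 hj.1.2))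
  have hinj : Function.Injective R := fun i j h => heq i j _ (hcorner i) (h ▸ hcorner i)
  let T : RectangleTiling n :=
    { tiles := Finset.univ.image R
      isRectangle := by
        intro S hS
        obtain ⟨i, -, rfl⟩ := Finset.mem_image.1 hS
        exact ⟨_, _, (Finset.nonempty_Icc.1 ⟨_, hcorner i⟩), rfl⟩
      pairwiseDisjoint := by
        intro S hS S' hS' hne
        obtain ⟨i, -, rfl⟩ := Finset.mem_image.1 hS
        obtain ⟨j, -, rfl⟩ := Finset.mem_image.1 hS'
        exact Finset.disjoint_left.2 fun c hi hj => hne (congrArg R (heq i j c hi hj))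
      union_eq := by
        ext c
        simp only [Finset.mem_biUnion, Finset.mem_image, Finset.mem_univ, true_and, id_eq,
          exists_exists_eq_and, mem_staircase]
        constructor
        · rintro ⟨i, hi⟩
          rw [hR] at hi
          omega
        · intro hc
          obtain ⟨i, hi, hmax⟩ := Finset.exists_max_image
            (Finset.univ.filter fun i : Fin (n - 1) => c.1 ≤ i.val ∧ i.val + c.2 + 2 ≤ n) key
            ⟨⟨c.1, by omega⟩, by simp; omega⟩
          refine ⟨i, (hR i c).2 ⟨by simpa using hi, fun j h1 h2 => hmax j (by simp [h1, h2])⟩⟩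
      card_eq := by
        rw [Finset.card_image_of_injective _ hinj, Finset.card_univ, Fintype.card_fin] }
  refine ⟨T, fun i c hc => ?_⟩
  have hT : T.tile i = R i :=
    T.eq_of_mem (T.tile_mem i) (Finset.mem_image_of_mem R (Finset.mem_univ i))
      (T.corner_mem_tile i) (hcorner i)
  rw [hT, hR] at hc
  exact hc.2

/-! ### Readings of tilings -/

/-- The box of the staircase with label `p`. -/
def labelBox (p : Fin n × Fin n) : ℕ × ℕ := (p.1.val, n - 1 - p.2.val)

theorem labelBox_injective : Function.Injective (labelBox (n := n)) := by
  rintro ⟨a, b⟩ ⟨c, d⟩ h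
  simp only [labelBox, Prod.mk.injEq] at h
  ext <;> simp only <;> omega

theorem labelBox_mem_staircase {p : Fin n × Fin n} (hp : p.1 < p.2) :
    labelBox p ∈ staircase n := by
  rw [mem_staircase, labelBox]
  rw [Fin.lt_def] at hp
  dsimp only
  omega

theorem boxEntry_eq (w : Equiv.Perm (Fin n)) (c : ℕ × ℕ) :
    boxEntry w c = if c ∈ (inversions w).image labelBox then 1 else 0 := by
  rw [boxEntry]
  refine if_congr ?_ rfl rfl
  rw [Finset.mem_image]
  refine exists_congr fun p => and_congr_right fun _ => ?_
  rw [labelBox, Prod.ext_iff]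
  dsimp only
  omega

theorem sum_boxEntry (w : Equiv.Perm (Fin n)) (R : Finset (ℕ × ℕ)) :
    ∑ c ∈ R, boxEntry w c = ∑ p ∈ inversions w, if labelBox p ∈ R then 1 else 0 := by
  simp only [boxEntry_eq]
  rw [← Finset.sum_image (s := inversions w) (g := labelBox) (f := fun c => if c ∈ R then 1 else 0)
    labelBox_injective.injOn]
  simp only [Finset.sum_boole, Nat.cast_id]
  congr 1
  ext c
  simp [and_comm]

namespace RectangleTiling

theorem exists_choice [Nonempty (Fin (n - 1))] (T : RectangleTiling n) (w : Equiv.Perm (Fin n)) :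
    ∃ g : Fin n × Fin n → Fin (n - 1), ∀ p ∈ inversions w, labelBox p ∈ T.tile (g p) := by
  have h : ∀ p : Fin n × Fin n, ∃ i : Fin (n - 1), p ∈ inversions w → labelBox p ∈ T.tile i := by
    intro p
    by_cases hp : p ∈ inversions w
    · obtain ⟨i, hi⟩ := T.exists_mem_tile (labelBox_mem_staircase (mem_inversions.1 hp).1)
      exact ⟨i, fun _ => hi⟩
    · exact ⟨Classical.arbitrary _, fun h => absurd h hp⟩
  choose g hg using h
  exact ⟨g, hg⟩

end RectangleTiling

theorem RectangleTiling.sum_boxEntry_tile {T : RectangleTiling n} {w : Equiv.Perm (Fin n)}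
    {g : Fin n × Fin n → Fin (n - 1)} (hg : ∀ p ∈ inversions w, labelBox p ∈ T.tile (g p))
    (i : Fin (n - 1)) :
    ∑ c ∈ T.tile i, boxEntry w c = countVector (inversions w) g i := by
  rw [sum_boxEntry, countVector]
  refine Finset.sum_congr rfl fun p hp => if_congr ?_ rfl rfl
  exact ⟨fun h => T.eq_of_mem_tile (hg p hp) h, fun h => h ▸ hg p hp⟩

theorem RectangleTiling.existsUnique_isReading (T : RectangleTiling n) (w : Equiv.Perm (Fin n)) :
    ∃! α : Fin (n - 1) → ℕ, IsReading w T α :=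
  ⟨fun i => ∑ c ∈ T.tile i, boxEntry w c, (T.isReading_iff w _).2 fun _ => rfl,
    fun _ h => funext ((T.isReading_iff w _).1 h)⟩

theorem RectangleTiling.mem_interval_of_labelBox_mem {T : RectangleTiling n} {p : Fin n × Fin n}
    {i : Fin (n - 1)} (h : labelBox p ∈ T.tile i) :
    p.1.val ≤ i.val ∧ i.val < p.2.val := by
  rw [T.mem_tile, labelBox] at h
  dsimp only at h
  omega

/-! ### Vertices of the Newton polytope -/

theorem extremePoints_newtonPolytope_dualSchubert [Nonempty (Fin (n - 1))]
    (w : Equiv.Perm (Fin n)) :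
    (newtonPolytope (dualSchubert w)).extremePoints ℝ =
      {v | ∃ (T : RectangleTiling n) (α : Fin (n - 1) → ℕ),
        IsReading w T α ∧ v = fun i => (α i : ℝ)} := by
  have hfin : ((fun (α : Fin (n - 1) →₀ ℕ) (i : Fin (n - 1)) => (α i : ℝ)) ''
      ((dualSchubert w).support : Set (Fin (n - 1) →₀ ℕ))).Finite :=
    (Finset.finite_toSet _).image _
  ext v
  rw [newtonPolytope, mem_extremePoints_convexHull_iff hfin, exponents_dualSchubert]
  constructor
  · rintro ⟨⟨g', hg', rfl⟩, c, hc⟩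
    -- The functional `c` may have ties; the second component breaks them. The reading of the
    -- resulting tiling does at least as well under `c`, so it equals the unique maximizer.
    obtain ⟨T, hT⟩ := exists_tiling_of_key (fun i => toLex (c i, i))
      (fun i j h => congrArg (fun x => (ofLex x).2) h)
    obtain ⟨g, hg⟩ := T.exists_choice w
    refine ⟨T, countVector (inversions w) g,
      (T.isReading_iff w _).2 fun i => (T.sum_boxEntry_tile hg i).symm, ?_⟩
    by_contra hne
    have hlt := hc (fun i => (countVector (inversions w) g i : ℝ))
      ⟨g, fun p hp => T.mem_interval_of_labelBox_mem (hg p hp), rfl⟩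
      (Ne.symm hne)
    rw [sum_mul_countVector, sum_mul_countVector] at hlt
    refine not_le.2 hlt (Finset.sum_le_sum fun p hp => ?_)
    have hp' := hg' p hp
    have := hT (g p) _ (hg p hp) (g' p) hp'.1 (by rw [labelBox]; dsimp only; omega)
    rcases Prod.Lex.toLex_le_toLex.1 this with h | h
    · exact le_of_lt h
    · exact le_of_eq h.1
  · rintro ⟨T, α, hα, rfl⟩
    obtain ⟨g, hg⟩ := T.exists_choice w
    obtain rfl : α = countVector (inversions w) g :=
      funext fun i => ((T.isReading_iff w _).1 hα i).trans (T.sum_boxEntry_tile hg i)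
    refine ⟨⟨g, fun p hp => T.mem_interval_of_labelBox_mem (hg p hp), rfl⟩, ?_⟩
    obtain ⟨key, hkey⟩ := T.exists_strict_key
    refine ⟨key, ?_⟩
    rintro _ ⟨g', hg', rfl⟩ hne
    rw [sum_mul_countVector, sum_mul_countVector]
    have hlt : ∀ p ∈ inversions w, g' p ≠ g p → key (g' p) < key (g p) := fun p hp h =>
      hkey _ _ (hg p hp) _ h (hg' p hp).1 (by
        have := (hg' p hp).2
        rw [labelBox]
        dsimp only
        omega)
    refine Finset.sum_lt_sum (fun p hp => ?_) ?_
    · by_cases h : g' p = g p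
      · rw [h]
      · exact (hlt p hp h).le
    · by_contra! hall
      refine hne (funext fun i => ?_)
      rw [countVector, countVector]
      refine congrArg _ (Finset.sum_congr rfl fun p hp => ?_)
      rw [show g' p = g p from by_contra fun h => not_le.2 (hlt p hp h) (hall p hp)]

/-- For `n ≤ 1` no choice function into `Fin (n - 1)` exists, but the ambient space is a point, so
it suffices that both sides are nonempty. -/
theorem extremePoints_newtonPolytope_dualSchubert_of_isEmpty [IsEmpty (Fin (n - 1))]
    (w : Equiv.Perm (Fin n)) :
    (newtonPolytope (dualSchubert w)).extremePoints ℝ =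
      {v | ∃ (T : RectangleTiling n) (α : Fin (n - 1) → ℕ),
        IsReading w T α ∧ v = fun i => (α i : ℝ)} := by
  have hn : n - 1 = 0 := by
    by_contra h
    exact IsEmpty.false (⟨0, Nat.pos_of_ne_zero h⟩ : Fin (n - 1))
  have hinv : inversions w = ∅ := by
    refine Finset.eq_empty_of_forall_notMem fun p hp => ?_
    have := Fin.lt_def.1 (mem_inversions.1 hp).1
    omega
  have hsupp : (0 : Fin (n - 1) →₀ ℕ) ∈ (dualSchubert w).support := by
    rw [support_dualSchubert, inversionProduct, hinv]
    simp
  obtain ⟨T, -⟩ := exists_tiling_of_key (n := n) (fun i => i) Function.injective_id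
  obtain ⟨α, hα, -⟩ := T.existsUnique_isReading w
  ext v
  rw [newtonPolytope, mem_extremePoints_convexHull_iff ((Finset.finite_toSet _).image _)]
  exact iff_of_true ⟨⟨0, hsupp, Subsingleton.elim _ _⟩, 0, fun y _ h =>
    absurd (Subsingleton.elim _ _) h⟩ ⟨T, α, hα, Subsingleton.elim _ _⟩

end DualSchubert

theorem mainTheorem7 (n : ℕ) (w : Equiv.Perm (Fin n)) :
    (∀ T : DualSchubert.RectangleTiling n,
      ∃! α : Fin (n - 1) → ℕ, DualSchubert.IsReading w T α) ∧
    (DualSchubert.newtonPolytope (DualSchubert.dualSchubert w)).extremePoints ℝ =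
      {v : Fin (n - 1) → ℝ | ∃ (T : DualSchubert.RectangleTiling n) (α : Fin (n - 1) → ℕ),
        DualSchubert.IsReading w T α ∧ v = fun i => (α i : ℝ)} := by
  refine ⟨fun T => T.existsUnique_isReading w, ?_⟩
  rcases isEmpty_or_nonempty (Fin (n - 1)) with h | h
  · exact DualSchubert.extremePoints_newtonPolytope_dualSchubert_of_isEmpty w
  · exact DualSchubert.extremePoints_newtonPolytope_dualSchubert w
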